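/- All rings are commutative with identity. For a ring $S$, let $\mathrm{gldim}(S)$ and $\mathrm{wdim}(S)$ be the global and the weak dimension of $S$, that is, the suprema of the projective, respectively flat, dimensions of all $S$-modules (the zero module having dimension $0$). The cotorsion dimension $\mathrm{cd}_S(C)$ of an $S$-module $C$ is the least integer $n\ge 0$ such that $\mathrm{Ext}_S^{n+1}(F,C)=0$ for all flat $S$-modules $F$ (and $\infty$ if there is none), and $\mathrm{cot.D}(S)=\sup\{\mathrm{cd}_S(C) : C \text{ an } S\text{-module}\}$. Let $V=\mathbb{Q}[X]_{(X)}$ be the localization of the polynomial ring $\mathbb{Q}[X]$ at the prime ideal $(X)$, and let $R=\mathbb{Z}+XV=\{n+Xv : n\in\mathbb{Z},\ v\in V\}$, a subring of $V$. Then $$\mathrm{gldim}(R)=2,\qquad \mathrm{wdim}(R)=1,\qquad \mathrm{cot.D}(R)=1.$$ In particular $\mathrm{cot.D}(R)<\mathrm{gldim}(R)$. Moreover the bound $\mathrm{gldim}(S)\le \mathrm{cot.D}(S)+\mathrm{wdim}(S)$, which holds for every commutative ring $S$, is attained by $R$: $\mathrm{gldim}(R)=\mathrm{cot.D}(R)+\mathrm{wdim}(R)$.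 -/

import Mathlib

open CategoryTheory Polynomial

universe u

/-- The projective dimension of an `R`-module, valued in `ℕ∞` (the zero module has dimension `0`). -/
noncomputable def projDim (R : Type u) [CommRing R] (M : ModuleCat.{u} R) : ℕ∞ :=
  (projectiveDimension M).unbotD 0

/-- The global dimension of `R`: the supremum of the projective dimensions of all `R`-modules. -/
noncomputable def globalDim (R : Type u) [CommRing R] : ℕ∞ :=
  ⨆ M : ModuleCat.{u} R, projDim R M

/-- `M` has a flat resolution `0 → F n → ⋯ → F 1 → F 0 → M → 0` of length at most `n`. -/
def HasFlatResolutionLE (R : Type u) [CommRing R] (M : ModuleCat.{u} R) (n : ℕ) : Prop :=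
  ∃ (F : ℕ → ModuleCat.{u} R) (d : ∀ i, F (i + 1) →ₗ[R] F i) (ε : F 0 →ₗ[R] M),
    (∀ i, Module.Flat R (F i)) ∧ (∀ i, n < i → Subsingleton (F i)) ∧
    Function.Surjective ε ∧ Function.Exact (d 0) ε ∧
    ∀ i, Function.Exact (d (i + 1)) (d i)

/-- The flat dimension of an `R`-module: the least length of a flat resolution, and `⊤` if there is
no finite one. -/
noncomputable def flatDim (R : Type u) [CommRing R] (M : ModuleCat.{u} R) : ℕ∞ :=
  ⨅ (n : ℕ) (_ : HasFlatResolutionLE R M n), (n : ℕ∞)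

/-- The weak dimension of `R`: the supremum of the flat dimensions of all `R`-modules. -/
noncomputable def weakDim (R : Type u) [CommRing R] : ℕ∞ :=
  ⨆ M : ModuleCat.{u} R, flatDim R M

/-- The cotorsion dimension of an `R`-module `C`: the least natural number `n` such that
`Ext^{n+1}(F, C) = 0` for every flat `R`-module `F`, and `⊤` if there is none. -/
noncomputable def cotorsionDim (R : Type u) [CommRing R] (C : ModuleCat.{u} R) : ℕ∞ :=
  ⨅ (n : ℕ) (_ : ∀ F : ModuleCat.{u} R, Module.Flat R F →
    Subsingleton (Abelian.Ext.{u} F C (n + 1))), (n : ℕ∞)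

/-- The global cotorsion dimension of `R`: the supremum of the cotorsion dimensions of all
`R`-modules. -/
noncomputable def globalCotorsionDim (R : Type u) [CommRing R] : ℕ∞ :=
  ⨆ C : ModuleCat.{u} R, cotorsionDim R C

instance isPrime_span_X_rat : (Ideal.span {(X : ℚ[X])}).IsPrime :=
  (Ideal.span_singleton_prime X_ne_zero).2 prime_X

/-- The discrete valuation domain `V = ℚ[X]_(X)`. -/
abbrev RatPolyLoc : Type := Localization.AtPrime (Ideal.span {(X : ℚ[X])})

/-- The subring `R = ℤ + X V` of `V = ℚ[X]_(X)`. -/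
def intAddXV : Subring RatPolyLoc where
  carrier := {z | ∃ (n : ℤ) (v : RatPolyLoc), z = n + algebraMap ℚ[X] RatPolyLoc X * v}
  zero_mem' := ⟨0, 0, by simp⟩
  one_mem' := ⟨1, 0, by simp⟩
  add_mem' := by
    rintro _ _ ⟨m, v, rfl⟩ ⟨n, w, rfl⟩
    exact ⟨m + n, v + w, by push_cast; ring⟩
  neg_mem' := by
    rintro _ ⟨m, v, rfl⟩
    exact ⟨-m, -v, by push_cast; ring⟩
  mul_mem' := by
    rintro _ _ ⟨m, v, rfl⟩ ⟨n, w, rfl⟩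
    exact ⟨m * n, m * w + n * v + algebraMap ℚ[X] RatPolyLoc X * v * w, by push_cast; ring⟩

/-! All upper bounds come from `R` being a countable Bézout domain. Each ideal is then the union of
an ascending sequence of cyclic submodules, so the telescope resolution gives it projective
dimension at most 1. Hence cyclic modules have dimension at most 2, and Auslander's theorem gives
gldim ≤ 2. The fraction field `K` is such a union as well. A flat module embeds in a direct sum of
copies of `K`, of dimension at most 1, with cokernel of dimension at most 2, so it has dimension at
most 1. This gives cot.D ≤ 1, since cot.D is the supremum of the projective dimensions of flat
modules. Finally, torsion-free modules are flat over a Bézout domain, so wdim ≤ 1.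

The only lower bound needed is gldim ≥ 2: the ideal `XV` is not projective, because every functional
`XV → R` has values in `XV`, and a dual basis would put `X` in `X²V`. The general inequality 2 ≤
cot.D + wdim then forces both summands to be 1. -/

section GeneralInequality

/-! ### Flat modules, cotorsion dimension and the general inequality. -/

variable {R : Type u} [CommRing R]

theorem projDim_le_iff (M : ModuleCat.{u} R) (n : ℕ) :
    projDim R M ≤ n ↔ HasProjectiveDimensionLT M (n + 1) := by
  rw [← HasProjectiveDimensionLE, ← projectiveDimension_le_iff, projDim,
    WithBot.unbotD_le_iff (by simp)]
  rfl

theorem globalDim_le_iff (n : ℕ) :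
    globalDim R ≤ n ↔ ∀ M : ModuleCat.{u} R, HasProjectiveDimensionLT M (n + 1) := by
  simp only [globalDim, iSup_le_iff, projDim_le_iff]

/-- The kernel of a surjection from a flat module onto a flat module is flat. -/
theorem Module.Flat.ker_of_surjective {M N : Type u} [AddCommGroup M] [Module R M]
    [AddCommGroup N] [Module R N] [Module.Flat R M] [Module.Flat R N] (f : M →ₗ[R] N)
    (hf : Function.Surjective f) : Module.Flat R (LinearMap.ker f) := by
  rw [Module.Flat.iff_lTensor_injectiveₛ]
  intro P _ _ N'
  let _ : AddCommGroup P := Module.addCommMonoidToAddCommGroup R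
  -- Flatness of the quotient `N` enters here: Tor₁(N, N') = 0.
  have h₁ : Function.Injective ((LinearMap.ker f).subtype.rTensor N') := by
    rw [← LinearMap.lTensor_inj_iff_rTensor_inj]
    exact LinearMap.lTensor_injective_of_exact_of_flat f hf _ (LinearMap.ker f).subtype_injective
      (LinearMap.exact_subtype_ker_map f) _
  have h₂ := Module.Flat.lTensor_preserves_injective_linearMap (M := M) N'.subtype
    Subtype.val_injective
  have h := h₂.comp h₁
  rw [← LinearMap.coe_comp, LinearMap.lTensor_comp_rTensor, ← LinearMap.rTensor_comp_lTensor,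
    LinearMap.coe_comp] at h
  exact h.of_comp

/-- Dimension shift along a projective cover term whose kernel is again flat. Vanishing thus
persists in higher degrees, so the least `n` in the definition governs all larger ones. -/
theorem subsingleton_ext_succ_of_flat {C : ModuleCat.{u} R} {n : ℕ}
    (h : ∀ F : ModuleCat.{u} R, Module.Flat R F → Subsingleton (Abelian.Ext.{u} F C (n + 1)))
    (F : ModuleCat.{u} R) (hF : Module.Flat R F) :
    Subsingleton (Abelian.Ext.{u} F C (n + 2)) := by
  have hS := F.shortExact_projectiveShortComplex
  have : Module.Flat R F.projectiveShortComplex.X₁ :=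
    Module.Flat.ker_of_surjective F.projectiveShortComplex.g.hom
      ((ModuleCat.epi_iff_surjective _).1 hS.epi_g)
  have := h _ this
  refine subsingleton_of_forall_eq 0 fun x ↦ ?_
  obtain ⟨y, rfl⟩ := Abelian.Ext.contravariant_sequence_exact₃ hS C x
    (Abelian.Ext.eq_zero_of_projective _) (add_comm 1 (n + 1))
  rw [Subsingleton.elim y 0, Abelian.Ext.comp_zero]

theorem cotorsionDim_le_iff (C : ModuleCat.{u} R) (n : ℕ) :
    cotorsionDim R C ≤ n ↔ ∀ F : ModuleCat.{u} R, Module.Flat R F →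
      Subsingleton (Abelian.Ext.{u} F C (n + 1)) := by
  refine ⟨fun h ↦ ?_, fun h ↦ iInf₂_le n h⟩
  have h' : cotorsionDim R C < (n + 1 : ℕ) := h.trans_lt (by norm_cast; simp)
  simp only [cotorsionDim, iInf_lt_iff] at h'
  obtain ⟨m, hm, hmn⟩ := h'
  have hmn : m ≤ n := by
    have := Nat.cast_lt.1 hmn
    omega
  induction n, hmn using Nat.le_induction with
  | base => exact hm
  | succ k hk ih =>
    exact subsingleton_ext_succ_of_flat
      (ih ((iInf₂_le m hm).trans (by exact_mod_cast hk)) (by exact_mod_cast Nat.lt_succ_of_le hk))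

/-- Both sides assert Ext^{n+1}(F, C) = 0 for all flat `F` and all `C`; only the order of
quantification differs. -/
theorem globalCotorsionDim_le_iff (n : ℕ) :
    globalCotorsionDim R ≤ n ↔
      ∀ F : ModuleCat.{u} R, Module.Flat R F → HasProjectiveDimensionLT F (n + 1) := by
  simp only [globalCotorsionDim, iSup_le_iff, cotorsionDim_le_iff]
  exact ⟨fun h F hF ↦ hasProjectiveDimensionLT_of_enoughInjectives F _ fun C ↦ h C F hF,
    fun h C F hF ↦ have := h F hF; HasProjectiveDimensionLT.subsingleton F (n + 1) _ le_rfl C⟩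

/-- Induction on the length: `ker ε` is resolved by the shifted complex, and each flat term raises
the bound by at most one beyond `c`. -/
theorem HasFlatResolutionLE.hasProjectiveDimensionLT {c : ℕ}
    (hc : ∀ F : ModuleCat.{u} R, Module.Flat R F → HasProjectiveDimensionLT F (c + 1))
    {n : ℕ} {M : ModuleCat.{u} R} (hM : HasFlatResolutionLE R M n) :
    HasProjectiveDimensionLT M (c + n + 1) := by
  induction n generalizing M with
  | zero =>
    obtain ⟨F, d, ε, hF, hF₀, hε, hd, -⟩ := hM
    have := hF₀ 1 one_pos
    have hinj : Function.Injective ε := by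
      rw [injective_iff_map_eq_zero]
      intro x hx
      obtain ⟨y, rfl⟩ := (hd x).1 hx
      rw [Subsingleton.elim y 0, map_zero]
    have := hc (F 0) (hF 0)
    exact hasProjectiveDimensionLT_of_iso (LinearEquiv.ofBijective ε ⟨hinj, hε⟩).toModuleIso _
  | succ n ih =>
    obtain ⟨F, d, ε, hF, hF₀, hε, hd, hd'⟩ := hM
    have hK : HasFlatResolutionLE R (ModuleCat.of R (LinearMap.ker ε)) n := by
      refine ⟨fun i ↦ F (i + 1), fun i ↦ d (i + 1),
        (d 0).codRestrict (LinearMap.ker ε) fun x ↦ hd.apply_apply_eq_zero x,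
        fun i ↦ hF _, fun i hi ↦ hF₀ _ (by omega), ?_, ?_, fun i ↦ hd' _⟩
      · rintro ⟨x, hx⟩
        obtain ⟨y, rfl⟩ := (hd x).1 hx
        exact ⟨y, rfl⟩
      · intro x
        rw [← hd' 0 x, Subtype.ext_iff]
        rfl
    have h₂ := hc (F 0) (hF 0)
    exact (LinearMap.shortExact_shortComplexKer hε).hasProjectiveDimensionLT_X₃ (c + n + 1) (ih hK)
      (hasProjectiveDimensionLT_of_ge _ (c + 1) _ (by omega))

theorem globalDim_le_globalCotorsionDim_add_weakDim (R : Type u) [CommRing R] :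
    globalDim R ≤ globalCotorsionDim R + weakDim R := by
  rcases hc : globalCotorsionDim R with _ | c
  · exact le_top.trans_eq (top_add _).symm
  rcases hw : weakDim R with _ | w
  · exact le_top.trans_eq (add_top _).symm
  have hc' := (globalCotorsionDim_le_iff c).1 hc.le
  change globalDim R ≤ (c : ℕ∞) + (w : ℕ∞)
  rw [← Nat.cast_add, globalDim_le_iff]
  intro M
  have h : flatDim R M < (w + 1 : ℕ) :=
    ((le_iSup (flatDim R) M).trans hw.le).trans_lt (Nat.cast_lt.2 w.lt_succ_self)
  simp only [flatDim, iInf_lt_iff] at h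
  obtain ⟨n, hn, hnw⟩ := h
  have := hn.hasProjectiveDimensionLT hc'
  exact hasProjectiveDimensionLT_of_ge _ (c + n + 1) _ (by have := Nat.cast_lt.1 hnw; omega)

end GeneralInequality

/-! ### Auslander's reduction to cyclic modules. -/

section Auslander

variable {R : Type u} [CommRing R]

/-- Baer's criterion: the obstruction to extending a map `I → C` to `R` lies in Ext¹(R/I, C). -/
theorem injective_of_subsingleton_ext_one (C : ModuleCat.{u} R)
    (h : ∀ I : Ideal R, Subsingleton (Abelian.Ext.{u} (ModuleCat.of R (R ⧸ I)) C 1)) :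
    Injective C := by
  change Injective (ModuleCat.of R C)
  rw [← Module.injective_iff_injective_object, ← Module.Baer.iff_injective]
  intro I g
  let S := ModuleCat.shortComplexOfCompEqZero I.subtype I.mkQ
    (LinearMap.exact_subtype_mkQ I).linearMap_comp_eq_zero
  have hS : S.ShortExact := ModuleCat.shortComplex_shortExact S (LinearMap.exact_subtype_mkQ I)
    Subtype.val_injective I.mkQ_surjective
  have := h I
  obtain ⟨x, hx⟩ := Abelian.Ext.contravariant_sequence_exact₁ hS C
    (Abelian.Ext.mk₀ (ModuleCat.ofHom g : S.X₁ ⟶ C)) (add_zero 1)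
    (Subsingleton.elim (h := h I) _ _)
  obtain ⟨φ, rfl⟩ := Abelian.Ext.homEquiv₀.symm.surjective x
  have hφ : S.f ≫ φ = ModuleCat.ofHom g :=
    Abelian.Ext.homEquiv₀.symm.injective (by simpa using hx)
  exact ⟨φ.hom, fun x hx ↦ LinearMap.congr_fun (congrArg ModuleCat.Hom.hom hφ) ⟨x, hx⟩⟩

theorem hasInjectiveDimensionLT_of_subsingleton_ext_quotient (n : ℕ) (C : ModuleCat.{u} R)
    (h : ∀ I : Ideal R, Subsingleton (Abelian.Ext.{u} (ModuleCat.of R (R ⧸ I)) C (n + 1))) :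
    HasInjectiveDimensionLT C (n + 1) := by
  induction n generalizing C with
  | zero => exact injective_iff_hasInjectiveDimensionLT_one.1 (injective_of_subsingleton_ext_one C h)
  | succ n ih =>
    let ⟨p⟩ := EnoughInjectives.presentation C
    have hS : (ShortComplex.mk _ _ (Limits.cokernel.condition p.f)).ShortExact :=
      { exact := ShortComplex.exact_cokernel p.f }
    refine (hS.hasInjectiveDimensionLT_X₃_iff n p.injective).1 (ih _ fun I ↦ ?_)
    refine subsingleton_of_forall_eq 0 fun x ↦ ?_
    obtain ⟨y, rfl⟩ := Abelian.Ext.covariant_sequence_exact₃ _ hS x rfl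
      (Subsingleton.elim (h := h I) _ _)
    rw [Abelian.Ext.eq_zero_of_injective y, Abelian.Ext.zero_comp]

/-- Auslander's theorem: the global dimension is detected on cyclic modules. -/
theorem hasProjectiveDimensionLT_of_forall_quotient (n : ℕ)
    (h : ∀ I : Ideal R, HasProjectiveDimensionLT (ModuleCat.of R (R ⧸ I)) (n + 1))
    (M : ModuleCat.{u} R) : HasProjectiveDimensionLT M (n + 1) := by
  refine hasProjectiveDimensionLT_of_enoughInjectives M _ fun C ↦ ?_
  have := hasInjectiveDimensionLT_of_subsingleton_ext_quotient n C fun I ↦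
    HasProjectiveDimensionLT.subsingleton (hX := h I) _ (n + 1) _ le_rfl C
  exact HasInjectiveDimensionLT.subsingleton C (n + 1) _ le_rfl M

end Auslander

/-! ### Telescope resolutions of ascending unions of cyclic modules. -/

section Telescope

variable {R : Type u} [CommRing R] (r : ℕ → R)

/-- The telescope map `e n ↦ e n - r n • e (n + 1)`. -/
noncomputable def telescopeMap : (ℕ →₀ R) →ₗ[R] (ℕ →₀ R) :=
  Finsupp.linearCombination R fun n ↦ Finsupp.single n 1 - Finsupp.single (n + 1) (r n)

theorem telescopeMap_single (n : ℕ) (c : R) : telescopeMap r (Finsupp.single n c) =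
    Finsupp.single n c - Finsupp.single (n + 1) (c * r n) := by
  simp [telescopeMap, smul_sub]

theorem telescopeMap_apply_zero (a : ℕ →₀ R) : telescopeMap r a 0 = a 0 := by
  induction a using Finsupp.induction_linear with
  | zero => simp
  | add f g hf hg => simp [hf, hg]
  | single n c => simp [telescopeMap_single]

theorem telescopeMap_apply_succ (a : ℕ →₀ R) (n : ℕ) :
    telescopeMap r a (n + 1) = a (n + 1) - a n * r n := by
  induction a using Finsupp.induction_linear with
  | zero => simp
  | add f g hf hg => simp only [map_add, Finsupp.add_apply, hf, hg]; ring
  | single m c =>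
    rw [telescopeMap_single]
    by_cases h : m = n
    · subst h; simp
    · simp [Finsupp.single_apply, h]

theorem telescopeMap_injective : Function.Injective (telescopeMap r) := by
  rw [injective_iff_map_eq_zero]
  intro a ha
  ext n
  induction n with
  | zero => rw [← telescopeMap_apply_zero r, ha]
  | succ n ih =>
    have := telescopeMap_apply_succ r a n
    rw [ha, ih] at this
    simpa using this.symm

/-- Modulo the image, `e n` equals `r n • e (n + 1)`, so all terms of a finite sum can be pushed to
one common late index. -/
theorem exists_eq_telescopeMap_add_single (y : ℕ →₀ R) :
    ∃ N a c, y = telescopeMap r a + Finsupp.single N c := by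
  have key : ∀ N k a c, ∃ b d, telescopeMap r a + Finsupp.single N c =
      telescopeMap r b + Finsupp.single (N + k) d := by
    intro N k a c
    induction k with
    | zero => exact ⟨a, c, rfl⟩
    | succ k ih =>
      obtain ⟨b, d, h⟩ := ih
      refine ⟨b + Finsupp.single (N + k) d, d * r (N + k), ?_⟩
      rw [h, map_add, telescopeMap_single, add_assoc, ← add_assoc N, sub_add_cancel]
  induction y using Finsupp.induction_linear with
  | zero => exact ⟨0, 0, 0, by simp⟩
  | single n c => exact ⟨n, 0, c, by simp⟩
  | add f g hf hg =>
    obtain ⟨N, a, c, rfl⟩ := hf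
    obtain ⟨N', a', c', rfl⟩ := hg
    obtain ⟨b, d, h⟩ := key N N' a c
    obtain ⟨b', d', h'⟩ := key N' N a' c'
    refine ⟨N + N', b + b', d + d', ?_⟩
    rw [h, h', map_add, Finsupp.single_add, add_comm N' N]
    abel

variable {r}

/-- A torsion-free module that is the union of an ascending sequence of cyclic modules has
projective dimension at most one. -/
theorem hasProjectiveDimensionLT_two_of_sequence [IsDomain R] {M : Type u} [AddCommGroup M]
    [Module R M] [Module.IsTorsionFree R M] (x : ℕ → M) (hx₀ : ∀ n, x n ≠ 0)
    (hx : ∀ n, x n = r n • x (n + 1)) (hM : ∀ m : M, ∃ n, ∃ c : R, m = c • x n) :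
    HasProjectiveDimensionLT (ModuleCat.of R M) 2 := by
  let f : (ℕ →₀ R) →ₗ[R] M := Finsupp.linearCombination R x
  have hf (n : ℕ) (c : R) : f (Finsupp.single n c) = c • x n := by simp [f]
  have hfg (a : ℕ →₀ R) : f (telescopeMap r a) = 0 := by
    induction a using Finsupp.induction_linear with
    | zero => simp
    | add a b ha hb => simp [ha, hb]
    | single n c => rw [telescopeMap_single, map_sub, hf, hf, hx n, mul_smul, sub_self]
  have hexact : Function.Exact (telescopeMap r) f := by
    intro y
    refine ⟨fun hy ↦ ?_, ?_⟩
    · obtain ⟨N, a, c, rfl⟩ := exists_eq_telescopeMap_add_single r y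
      -- Torsion-freeness makes the remaining coefficient `c` vanish.
      rw [map_add, hfg, zero_add, hf, smul_eq_zero_iff_left (hx₀ N)] at hy
      exact ⟨a, by simp [hy]⟩
    · rintro ⟨a, rfl⟩
      exact hfg a
  have hsurj : Function.Surjective f := fun m ↦ by
    obtain ⟨n, c, rfl⟩ := hM m
    exact ⟨Finsupp.single n c, hf n c⟩
  let S := ModuleCat.shortComplexOfCompEqZero (telescopeMap r) f hexact.linearMap_comp_eq_zero
  have hS : S.ShortExact :=
    ModuleCat.shortComplex_shortExact S hexact (telescopeMap_injective r) hsurj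
  have : Projective (ModuleCat.of R (ℕ →₀ R)) :=
    (IsProjective.iff_projective _).1 inferInstance
  exact hS.hasProjectiveDimensionLT_X₃ 1 (inferInstanceAs (HasProjectiveDimensionLT
    (ModuleCat.of R (ℕ →₀ R)) 1)) (inferInstanceAs (HasProjectiveDimensionLT
    (ModuleCat.of R (ℕ →₀ R)) 2))

/-- A countable torsion-free module all of whose finitely generated submodules are contained in
cyclic ones has projective dimension at most one. -/
theorem hasProjectiveDimensionLT_two_of_countable [IsDomain R] (M : Type u) [AddCommGroup M]
    [Module R M] [Module.IsTorsionFree R M] [Countable M]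
    (h : ∀ a b : M, ∃ d : M, (∃ p : R, a = p • d) ∧ ∃ q : R, b = q • d) :
    HasProjectiveDimensionLT (ModuleCat.of R M) 2 := by
  rcases subsingleton_or_nontrivial M with hM | hM
  · have : Projective (ModuleCat.of R M) := (IsProjective.iff_projective _).1 inferInstance
    infer_instance
  obtain ⟨x₀, hx₀⟩ := exists_ne (0 : M)
  obtain ⟨e, he⟩ := exists_surjective_nat M
  choose d h₁ h₂ using h
  choose p hp using h₁
  choose q hq using h₂
  -- Each `x (n + 1)` has both `x n` and `e n` as multiples, so the chain absorbs the whole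
  -- enumeration.
  let x : ℕ → M := fun n ↦ Nat.rec x₀ (fun n y ↦ d y (e n)) n
  have hx (n : ℕ) : x n = p (x n) (e n) • x (n + 1) := hp _ _
  refine hasProjectiveDimensionLT_two_of_sequence x (fun n ↦ ?_) hx fun m ↦ ?_
  · induction n with
    | zero => exact hx₀
    | succ n ih =>
      intro h0
      exact ih (by rw [hx, h0, smul_zero])
  · obtain ⟨n, rfl⟩ := he m
    exact ⟨n + 1, q (x n) (e n), hq _ _⟩

end Telescope

/-! ### Homological bounds over countable Bézout domains. -/

section CountableBezout

variable {R : Type u} [CommRing R]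

theorem IsBezout.exists_common_divisor [IsBezout R] (a b : R) :
    ∃ d p q u v : R, a = p * d ∧ b = q * d ∧ d = u * a + v * b := by
  obtain ⟨p, hp⟩ := IsBezout.gcd_dvd_left a b
  obtain ⟨q, hq⟩ := IsBezout.gcd_dvd_right a b
  obtain ⟨u, v, huv⟩ := IsBezout.gcd_eq_sum a b
  exact ⟨_, p, q, u, v, hp.trans (mul_comm _ _), hq.trans (mul_comm _ _), huv.symm⟩

theorem hasProjectiveDimensionLT_two_ideal [IsDomain R] [IsBezout R] [Countable R] (I : Ideal R) :
    HasProjectiveDimensionLT (ModuleCat.of R I) 2 := by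
  refine hasProjectiveDimensionLT_two_of_countable I ?_
  rintro ⟨a, ha⟩ ⟨b, hb⟩
  obtain ⟨d, p, q, u, v, hp, hq, hd⟩ := IsBezout.exists_common_divisor a b
  refine ⟨⟨d, ?_⟩, ⟨p, Subtype.ext hp⟩, ⟨q, Subtype.ext hq⟩⟩
  rw [hd]
  exact I.add_mem (I.mul_mem_left _ ha) (I.mul_mem_left _ hb)

theorem hasProjectiveDimensionLT_three [IsDomain R] [IsBezout R] [Countable R]
    (M : ModuleCat.{u} R) : HasProjectiveDimensionLT M 3 := by
  refine hasProjectiveDimensionLT_of_forall_quotient 2 (fun I ↦ ?_) M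
  let S := ModuleCat.shortComplexOfCompEqZero I.subtype I.mkQ
    (LinearMap.exact_subtype_mkQ I).linearMap_comp_eq_zero
  have hS : S.ShortExact := ModuleCat.shortComplex_shortExact S (LinearMap.exact_subtype_mkQ I)
    Subtype.val_injective I.mkQ_surjective
  have : Projective S.X₂ := (IsProjective.iff_projective R).1 inferInstance
  exact (hS.hasProjectiveDimensionLT_X₃_iff 1 this).2 (hasProjectiveDimensionLT_two_ideal I)

theorem hasProjectiveDimensionLT_two_fractionRing [IsDomain R] [IsBezout R] [Countable R] :
    HasProjectiveDimensionLT (ModuleCat.of R (FractionRing R)) 2 := by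
  have : Countable (FractionRing R) :=
    (IsLocalization.mk'_surjective (nonZeroDivisors R) (S := FractionRing R)).countable
  refine hasProjectiveDimensionLT_two_of_countable _ fun a b ↦ ?_
  obtain ⟨a, s, hs, rfl⟩ := IsFractionRing.div_surjective (A := R) a
  obtain ⟨b, t, ht, rfl⟩ := IsFractionRing.div_surjective (A := R) b
  -- Over the common denominator `s * t`, the two fractions have numerators `a * t` and `b * s`.
  obtain ⟨d, p, q, u, v, hp, hq, hd⟩ := IsBezout.exists_common_divisor (a * t) (b * s)
  have hs' : algebraMap R (FractionRing R) s ≠ 0 := by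
    simpa using nonZeroDivisors.ne_zero hs
  have ht' : algebraMap R (FractionRing R) t ≠ 0 := by
    simpa using nonZeroDivisors.ne_zero ht
  refine ⟨algebraMap R _ d / (algebraMap R _ s * algebraMap R _ t), ⟨p, ?_⟩, ⟨q, ?_⟩⟩
  · rw [Algebra.smul_def, ← mul_div_assoc, ← map_mul, ← hp, map_mul]
    field_simp
  · rw [Algebra.smul_def, ← mul_div_assoc, ← map_mul, ← hq, map_mul]
    field_simp

theorem hasProjectiveDimensionLT_two_finsupp_of_exact {K P M : Type u} [AddCommGroup K]
    [Module R K] [AddCommGroup P] [Module R P] [AddCommGroup M] [Module R M]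
    [Module.Projective R K] [Module.Projective R P] {f : K →ₗ[R] P} {g : P →ₗ[R] M}
    (hf : Function.Injective f) (hfg : Function.Exact f g) (hg : Function.Surjective g)
    (ι : Type u) : HasProjectiveDimensionLT (ModuleCat.of R (ι →₀ M)) 2 := by
  have hexact : Function.Exact (Finsupp.mapRange.linearMap (α := ι) f)
      (Finsupp.mapRange.linearMap (α := ι) g) := by
    rw [LinearMap.exact_iff, Finsupp.ker_mapRange, Finsupp.range_mapRange_linearMap _
      (LinearMap.ker_eq_bot.2 hf), LinearMap.exact_iff.1 hfg]
  let S := ModuleCat.shortComplexOfCompEqZero _ _ hexact.linearMap_comp_eq_zero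
  have hS : S.ShortExact := ModuleCat.shortComplex_shortExact S hexact
    (Finsupp.mapRange_injective _ (map_zero _) hf) (Finsupp.mapRange_surjective _ (map_zero _) hg)
  have proj (Q : Type u) [AddCommGroup Q] [Module R Q] [Module.Projective R Q] :
      Projective (ModuleCat.of R (ι →₀ Q)) := by
    classical
    exact (IsProjective.iff_projective _).1 (.of_equiv (finsuppLequivDFinsupp R).symm)
  exact (hS.hasProjectiveDimensionLT_X₃_iff 0 (proj P)).2
    (projective_iff_hasProjectiveDimensionLT_one.1 (proj K))

/-- The kernel of a free cover of `M` is projective; direct sums of this length-one resolution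
remain projective resolutions. -/
theorem hasProjectiveDimensionLT_two_finsupp {M : Type u} [AddCommGroup M] [Module R M]
    (hM : HasProjectiveDimensionLT (ModuleCat.of R M) 2) (ι : Type u) :
    HasProjectiveDimensionLT (ModuleCat.of R (ι →₀ M)) 2 := by
  let f : (M →₀ R) →ₗ[R] M := Finsupp.linearCombination R id
  have hf : Function.Surjective f := Finsupp.linearCombination_surjective R Function.surjective_id
  have hP : Projective (ModuleCat.of R (M →₀ R)) := (IsProjective.iff_projective _).1 inferInstance
  have hK : Module.Projective R (LinearMap.ker f) :=
    (IsProjective.iff_projective _).2 (projective_iff_hasProjectiveDimensionLT_one.2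
      (((LinearMap.shortExact_shortComplexKer hf).hasProjectiveDimensionLT_X₃_iff 0 hP).1 hM))
  exact hasProjectiveDimensionLT_two_finsupp_of_exact (K := LinearMap.ker f)
    (f := (LinearMap.ker f).subtype) (LinearMap.ker f).subtype_injective
    (LinearMap.exact_subtype_ker_map f) hf ι

/-- Over a countable Bézout domain flat modules have projective dimension at most one. -/
theorem hasProjectiveDimensionLT_two_of_flat [IsDomain R] [IsBezout R] [Countable R]
    (F : ModuleCat.{u} R) [Module.Flat R F] : HasProjectiveDimensionLT F 2 := by
  have : Module.IsTorsionFree R F :=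
    Submodule.isTorsionFree_iff_torsion_eq_bot.2 Module.Flat.torsion_eq_bot
  let L := LocalizedModule (nonZeroDivisors R) F
  let i : F →ₗ[R] L := LocalizedModule.mkLinearMap (nonZeroDivisors R) F
  have hi : Function.Injective i :=
    (IsLocalizedModule.injective_iff_isRegular (nonZeroDivisors R) i).2 fun c ↦
      IsSMulRegular.of_ne_zero (nonZeroDivisors.ne_zero c.2)
  let _ : Module (FractionRing R) L := 
    inferInstanceAs (Module (Localization (nonZeroDivisors R)) L)
  have : IsScalarTower R (FractionRing R) L :=
    inferInstanceAs (IsScalarTower R (Localization (nonZeroDivisors R)) L)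
  let b := Module.Basis.ofVectorSpace (FractionRing R) L
  have := hasProjectiveDimensionLT_two_finsupp (R := R) hasProjectiveDimensionLT_two_fractionRing
    (Module.Basis.ofVectorSpaceIndex (FractionRing R) L)
  have hL : HasProjectiveDimensionLT (ModuleCat.of R L) 2 :=
    hasProjectiveDimensionLT_of_iso (b.repr.symm.restrictScalars R).toModuleIso 2
  let S := ModuleCat.shortComplexOfCompEqZero i _ i.exact_map_mkQ_range.linearMap_comp_eq_zero
  have hS : S.ShortExact := ModuleCat.shortComplex_shortExact S
    i.exact_map_mkQ_range hi (Submodule.mkQ_surjective _)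
  -- The cokernel of `F → L` has dimension at most 2, one more than the bound for `L`, so `F`
  -- inherits the bound 1.
  exact hS.hasProjectiveDimensionLT_X₁ 2 hL (hasProjectiveDimensionLT_three _)

theorem globalDim_le_two [IsDomain R] [IsBezout R] [Countable R] : globalDim R ≤ (2 : ℕ) :=
  (globalDim_le_iff 2).2 hasProjectiveDimensionLT_three

theorem globalCotorsionDim_le_one [IsDomain R] [IsBezout R] [Countable R] :
    globalCotorsionDim R ≤ (1 : ℕ) :=
  (globalCotorsionDim_le_iff 1).2 fun F _ ↦ hasProjectiveDimensionLT_two_of_flat F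

/-- A module with a presentation by flat modules with injective differential has flat dimension at
most one. -/
theorem hasFlatResolutionLE_one {M : ModuleCat.{u} R} {P : Type u} [AddCommGroup P] [Module R P]
    [Module.Flat R P] (f : P →ₗ[R] M) (hf : Function.Surjective f)
    (hK : Module.Flat R (LinearMap.ker f)) : HasFlatResolutionLE R M 1 := by
  let F : ℕ → ModuleCat.{u} R
    | 0 => ModuleCat.of R P
    | 1 => ModuleCat.of R (LinearMap.ker f)
    | _ + 2 => ModuleCat.of R PUnit
  let d : ∀ i, F (i + 1) →ₗ[R] F i
    | 0 => (LinearMap.ker f).subtype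
    | _ + 1 => 0
  have hsub (i : ℕ) : Subsingleton (F (i + 2)) := inferInstanceAs (Subsingleton PUnit.{u + 1})
  refine ⟨F, d, f, ?_, ?_, hf, LinearMap.exact_subtype_ker_map f, ?_⟩
  · rintro (_ | _ | i)
    · exact ‹Module.Flat R P›
    · exact hK
    · exact inferInstanceAs (Module.Flat R PUnit.{u + 1})
  · rintro (_ | _ | i) hi
    · omega
    · omega
    · exact hsub i
  · rintro (_ | i)
    · exact LinearMap.exact_zero_iff_injective _ _ |>.2 (LinearMap.ker f).subtype_injective
    · have := hsub i
      exact LinearMap.exact_zero_iff_injective _ _ |>.2 (Function.injective_of_subsingleton _)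

theorem Module.Flat.of_isTorsionFree_of_isBezout [IsDomain R] [IsBezout R] (M : Type u)
    [AddCommGroup M] [Module R M] [Module.IsTorsionFree R M] : Module.Flat R M :=
  Module.Flat.flat_iff_torsion_eq_bot_of_isBezout.2
    (Submodule.isTorsionFree_iff_torsion_eq_bot.1 inferInstance)

theorem weakDim_le_one [IsDomain R] [IsBezout R] : weakDim R ≤ (1 : ℕ) :=
  iSup_le fun M ↦ iInf₂_le 1 (hasFlatResolutionLE_one
    (Finsupp.linearCombination R (id : M → M))
    (Finsupp.linearCombination_surjective R Function.surjective_id)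
    (Module.Flat.of_isTorsionFree_of_isBezout
      (LinearMap.ker (Finsupp.linearCombination R (id : M → M)))))

end CountableBezout

/-! ### The ring ℤ + XV: countable, Bézout, with `XV` not projective. -/

section IntAddXV

/-- The image of `X` in `ℚ[X]_(X)`. -/
local notation "ϖ" => algebraMap ℚ[X] RatPolyLoc X

/-- A rational number as a constant of `ℚ[X]_(X)`. -/
local notation "κ" => algebraMap ℚ RatPolyLoc

instance : Countable intAddXV := by
  have : Countable ℚ[X] := Function.Injective.countable (f := fun p : ℚ[X] ↦ p.toFinsupp.coeff)
    fun p q h ↦ Polynomial.toFinsupp_injective (AddMonoidAlgebra.coeff_injective h)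
  have : Countable RatPolyLoc := (IsLocalization.mk'_surjective
    (Ideal.span {(X : ℚ[X])}).primeCompl (S := RatPolyLoc)).countable
  exact Subtype.val_injective.countable

/-- Every element of `ℚ[X]_(X)` is congruent to a rational number modulo `X`. -/
theorem exists_rat_add_X_mul (v : RatPolyLoc) : ∃ (q : ℚ) (w : RatPolyLoc), v = κ q + ϖ * w := by
  obtain ⟨f, g, rfl⟩ := IsLocalization.exists_mk'_eq (Ideal.span {(X : ℚ[X])}).primeCompl v
  have hg : g.1.coeff 0 ≠ 0 := by
    have := g.2
    rwa [Ideal.mem_primeCompl_iff, Ideal.mem_span_singleton, X_dvd_iff] at this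
  obtain ⟨h, hh⟩ : X ∣ f - C (f.coeff 0 / g.1.coeff 0) * g.1 := by
    rw [X_dvd_iff]
    simp [hg]
  refine ⟨f.coeff 0 / g.1.coeff 0, IsLocalization.mk' _ h g, ?_⟩
  rw [IsLocalization.mk'_eq_iff_eq_mul, add_mul, mul_assoc, IsLocalization.mk'_spec,
    IsScalarTower.algebraMap_apply ℚ ℚ[X] RatPolyLoc, ← map_mul, ← map_mul, ← map_add, ← hh]
  simp

theorem not_isUnit_X : ¬ IsUnit ϖ := by
  rw [IsLocalization.AtPrime.isUnit_to_map_iff RatPolyLoc (Ideal.span {(X : ℚ[X])}),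
    Ideal.mem_primeCompl_iff, not_not]
  exact Ideal.mem_span_singleton_self X

theorem X_ratPolyLoc_ne_zero : ϖ ≠ 0 := by
  rw [Ne, map_eq_zero_iff _ (IsLocalization.injective RatPolyLoc
    (Ideal.span {(X : ℚ[X])}).primeCompl_le_nonZeroDivisors)]
  exact X_ne_zero

/-- Nonzero integers are units of `V`, while `X` is not; so ℤ ∩ XV = 0. -/
theorem intCast_eq_zero_of_eq_X_mul {n : ℤ} {v : RatPolyLoc} (h : (n : RatPolyLoc) = ϖ * v) :
    n = 0 := by
  by_contra hn
  have hu : IsUnit (κ n) := (IsUnit.mk0 (n : ℚ) (by exact_mod_cast hn)).map κ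
  rw [map_intCast, h] at hu
  exact not_isUnit_X (isUnit_of_mul_isUnit_left hu)

theorem exists_common_divisor_of_dvd {a b : intAddXV} (h : (a : RatPolyLoc) ∣ b) :
    ∃ d : intAddXV, d ∈ Ideal.span {a, b} ∧ d ∣ a ∧ d ∣ b := by
  obtain ⟨v, hv⟩ := h
  obtain ⟨q, w, rfl⟩ := exists_rat_add_X_mul v
  obtain ⟨s, t, hst⟩ : IsCoprime (q.den : ℤ) q.num :=
    q.isCoprime_num_den.symm
  have hden : κ q * q.den = q.num := by
    rw [← map_natCast κ, ← map_intCast κ, ← map_mul, Rat.mul_den_eq_num]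
  have hst' : (s : RatPolyLoc) * q.den + t * q.num = 1 := by
    exact_mod_cast congrArg (Int.cast (R := RatPolyLoc)) hst
  let c (w : RatPolyLoc) : intAddXV := ⟨ϖ * w, 0, w, by simp⟩
  -- With `b = a (q + Xw)`, this generator is `a / q.den`, expressed through the Bézout relation `s
  -- * q.den + t * q.num = 1`.
  refine ⟨(s - t * c w) * a + t * b, Ideal.mem_span_pair.2 ⟨_, _, rfl⟩,
    ⟨q.den, Subtype.ext ?_⟩, ⟨q.num + q.den * c w, Subtype.ext ?_⟩⟩
  · simp only [c, Subring.coe_mul, Subring.coe_add, AddSubgroupClass.coe_sub, Subring.coe_intCast,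
      Subring.coe_natCast, hv]
    linear_combination (-a : RatPolyLoc) * hst' + (-a * t : RatPolyLoc) * hden
  · simp only [c, Subring.coe_mul, Subring.coe_add, AddSubgroupClass.coe_sub, Subring.coe_intCast,
      Subring.coe_natCast, hv]
    linear_combination (-a * (κ q + ϖ * w) : RatPolyLoc) * hst' +
      (a * (s - t * (ϖ * w)) : RatPolyLoc) * hden

instance : IsDiscreteValuationRing RatPolyLoc :=
  IsLocalization.AtPrime.isDiscreteValuationRing_of_dedekind_domain ℚ[X]
    (P := Ideal.span {(X : ℚ[X])}) (by simp) RatPolyLoc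

instance : IsBezout intAddXV := by
  rw [IsBezout.iff_span_pair_isPrincipal]
  have key {a b d : intAddXV} (h : d ∈ Ideal.span {a, b} ∧ d ∣ a ∧ d ∣ b) :
      (Ideal.span {a, b}).IsPrincipal := by
    refine ⟨d, le_antisymm ?_ ?_⟩
    · rw [Ideal.span_le]
      rintro x (rfl | rfl)
      · exact Ideal.mem_span_singleton.2 h.2.1
      · exact Ideal.mem_span_singleton.2 h.2.2
    · exact (Ideal.span_singleton_le_iff_mem _).2 h.1
  intro a b
  rcases ValuationRing.dvd_total (a : RatPolyLoc) b with h | h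
  · obtain ⟨d, hd⟩ := exists_common_divisor_of_dvd h
    exact key hd
  · obtain ⟨d, hd⟩ := exists_common_divisor_of_dvd h
    rw [Ideal.span_pair_comm]
    exact key hd

/-- The ideal `X ^ k V ∩ R` of `R = ℤ + X V`. -/
noncomputable def idealXV (k : ℕ) : Ideal intAddXV :=
  (Ideal.span {ϖ ^ k}).comap intAddXV.subtype

theorem mem_idealXV {k : ℕ} {r : intAddXV} : r ∈ idealXV k ↔ ϖ ^ k ∣ (r : RatPolyLoc) := by
  rw [idealXV, Ideal.mem_comap, Ideal.mem_span_singleton]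
  rfl

/-- `XV` is divisible by every nonzero integer, so the integer part of a value `f x` is too, and
hence is zero. -/
theorem linearMap_apply_mem_idealXV (f : idealXV 1 →ₗ[intAddXV] intAddXV) (x : idealXV 1) :
    f x ∈ idealXV 1 := by
  obtain ⟨n, v, hn⟩ := (f x).2
  rcases eq_or_ne n 0 with rfl | hn₀
  · rw [mem_idealXV, hn]
    simp
  obtain ⟨w, hw⟩ := mem_idealXV.1 x.2
  -- Here `y = x / (2n)`: comparing integer parts in `f x = 2n • f y` gives `n = 2nm`, which the
  -- factor 2 makes impossible for `n ≠ 0`.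
  let y : idealXV 1 := ⟨⟨ϖ * (κ (1 / (2 * n)) * w), 0, κ (1 / (2 * n)) * w,
    by rw [Int.cast_zero, zero_add]⟩,
    mem_idealXV.2 ⟨_, by rw [pow_one]⟩⟩
  have hκ : ((2 * n : ℤ) : RatPolyLoc) * κ (1 / (2 * n)) = 1 := by
    rw [← map_intCast κ, ← map_mul, ← map_one κ]
    congr 1
    have : (n : ℚ) ≠ 0 := by exact_mod_cast hn₀
    push_cast
    field_simp
  have hxy : x = ((2 * n : ℤ) : intAddXV) • y := by
    refine Subtype.ext (Subtype.ext ?_)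
    change (x : RatPolyLoc) = ((2 * n : ℤ) : RatPolyLoc) * (ϖ * (κ (1 / (2 * n)) * w))
    rw [hw]
    linear_combination (-ϖ * w) * hκ
  obtain ⟨m, v', hm⟩ := (f y).2
  have h : (f x : RatPolyLoc) = ((2 * n : ℤ) : RatPolyLoc) * f y := by
    conv_lhs => rw [hxy, map_smul]
    rfl
  rw [hn, hm] at h
  have := intCast_eq_zero_of_eq_X_mul (n := n - 2 * n * m) (v := (2 * n : ℤ) * v' - v) (by
    push_cast at h ⊢
    linear_combination h)
  have h1 : n * (1 - 2 * m) = 0 := by linear_combination this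
  rcases mul_eq_zero.1 h1 with h1 | h1
  · exact absurd h1 hn₀
  · omega

theorem not_projective_idealXV : ¬ Module.Projective intAddXV (idealXV 1) := by
  rintro ⟨s, hs⟩
  let x : idealXV 1 := ⟨⟨ϖ, 0, 1, by simp⟩, mem_idealXV.2 (by simp)⟩
  -- The section `s` writes `X` as a sum of products of a functional value and an ideal element,
  -- both divisible by `X` in `V`.
  have hx : (x : intAddXV) ∈ idealXV 2 := by
    rw [← hs x, Finsupp.linearCombination_apply, Finsupp.sum, Submodule.coe_sum]
    refine Submodule.sum_mem _ fun e _ ↦ mem_idealXV.2 ?_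
    have h₁ := mem_idealXV.1 (linearMap_apply_mem_idealXV (Finsupp.lapply e ∘ₗ s) x)
    have h₂ := mem_idealXV.1 e.2
    have := mul_dvd_mul h₁ h₂
    rw [← pow_add] at this
    exact this
  obtain ⟨v, hv⟩ := mem_idealXV.1 hx
  refine not_isUnit_X (IsUnit.of_mul_eq_one v (mul_left_cancel₀ X_ratPolyLoc_ne_zero ?_))
  rw [← mul_assoc, ← sq, ← hv, mul_one]

theorem two_le_globalDim_intAddXV : 2 ≤ globalDim intAddXV := by
  by_contra! h
  have h1 : globalDim intAddXV ≤ (1 : ℕ) :=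
    Order.le_of_lt_add_one (by simpa [one_add_one_eq_two] using h)
  have h2 := (globalDim_le_iff 1).1 h1 (ModuleCat.of intAddXV (intAddXV ⧸ idealXV 1))
  let S := ModuleCat.shortComplexOfCompEqZero (idealXV 1).subtype (idealXV 1).mkQ
    (LinearMap.exact_subtype_mkQ (idealXV 1)).linearMap_comp_eq_zero
  have hS : S.ShortExact := ModuleCat.shortComplex_shortExact S
    (LinearMap.exact_subtype_mkQ (idealXV 1)) Subtype.val_injective (idealXV 1).mkQ_surjective
  have hP : Projective S.X₂ := (IsProjective.iff_projective intAddXV).1 inferInstance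
  exact not_projective_idealXV ((IsProjective.iff_projective _).2
    (projective_iff_hasProjectiveDimensionLT_one.2
      ((hS.hasProjectiveDimensionLT_X₃_iff 0 hP).1 h2)))

end IntAddXV

theorem mainTheorem9 :
    (globalDim intAddXV = 2 ∧ weakDim intAddXV = 1 ∧ globalCotorsionDim intAddXV = 1) ∧
    globalCotorsionDim intAddXV < globalDim intAddXV ∧
    -- the upper bound for the global dimension holds for all rings, and `ℤ + X V` attains it
    (∀ (S : Type u) [CommRing S], globalDim S ≤ globalCotorsionDim S + weakDim S) ∧
    globalDim intAddXV = globalCotorsionDim intAddXV + weakDim intAddXV := by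
  have hg : globalDim intAddXV = 2 := le_antisymm globalDim_le_two two_le_globalDim_intAddXV
  have hcw := hg ▸ globalDim_le_globalCotorsionDim_add_weakDim intAddXV
  have hc : globalCotorsionDim intAddXV ≤ 1 := globalCotorsionDim_le_one
  have hw : weakDim intAddXV ≤ 1 := weakDim_le_one
  -- Two numbers at most 1 whose sum is at least 2 must both be 1.
  obtain ⟨hc, hw⟩ : globalCotorsionDim intAddXV = 1 ∧ weakDim intAddXV = 1 := by
    lift globalCotorsionDim intAddXV to ℕ using ne_top_of_le_ne_top ENat.one_ne_top hc with c
    lift weakDim intAddXV to ℕ using ne_top_of_le_ne_top ENat.one_ne_top hw with w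
    norm_cast at hcw hc hw ⊢
    omega
  rw [hg, hc, hw]
  refine ⟨⟨rfl, rfl, rfl⟩, by norm_num, fun S _ ↦ globalDim_le_globalCotorsionDim_add_weakDim S, ?_⟩
  norm_num
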